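/- Model of computation: a Word RAM whose words have $W$ bits. A program is a finite list of instructions (load a constant, arithmetic and bitwise operations modulo $2^W$, integer division and remainder, indirect load and store, conditional jumps, halt), every executed instruction costs one time unit, and the evaluation starts with the description of the hash function followed by the input vector in memory. Theorem. For every constant $\varepsilon>0$ there are a program $P$ and constants $c,k\in\mathbb{N}$ with $c\ge 1$, and $C\in\mathbb{R}$, all depending only on $\varepsilon$, such that the following holds for all integers $n\ge 1$ and $N\ge 1$, every prime $p$ and every integer $w$ with $w\ge\log_2 p$ and $w\ge\log_2 n$. Let $U=\{0,\dots,p-1\}$. There are $k$ fixed words $\theta\in\{0,\dots,2^{cw}-1\}^k$, an integer $1\le q\le 2^{cw}$ and a family of functions $H_r:U^n\to\mathbb{N}$, indexed by $r\in\{0,\dots,q-1\}^k$, such that 1. (constant description size, efficient evaluation) $H_r$ is described by the $2k$ words $(\theta,r)$ of $cw$ bits each: for all $r$ and all $\mathbf{x}\in U^n$, the program $P$, run on the Word RAM with $cw$-bit words on $(\theta,r,\mathbf{x})$, halts after at most $C\,n\log p$ steps with output $H_r(\mathbf{x})$; 2. (collision probability) for $r$ uniformly distributed over $\{0,\dots,q-1\}^k$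 and all $\mathbf{x},\mathbf{y}\in U^n$ of weight $\sum_i x_i=\sum_i y_i=N$, $$\Pr_r[H_r(\mathbf{x})=H_r(\mathbf{y})]\in[J-\varepsilon,\,J+\varepsilon],\qquad J=\frac{\sum_i\min(x_i,y_i)}{\sum_i\max(x_i,y_i)}.$$ -/

import Mathlib

namespace WordRAM

/-- The arithmetic, bitwise and shift operations of the word RAM. -/
inductive BinOp where
  | add | sub | mul | div | rem | and | or | xor | shl | shr

/-- The value of an operation on two `W`-bit words, as a `W`-bit word: addition, subtraction,
multiplication and left shift wrap around modulo `2 ^ W`; division rounds down. -/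
def BinOp.eval (W : ℕ) : BinOp → ℕ → ℕ → ℕ
  | .add, a, b => (a + b) % 2 ^ W
  | .sub, a, b => (a + (2 ^ W - b)) % 2 ^ W
  | .mul, a, b => (a * b) % 2 ^ W
  | .div, a, b => a / b
  | .rem, a, b => a % b
  | .and, a, b => a &&& b
  | .or, a, b => a ||| b
  | .xor, a, b => a ^^^ b
  | .shl, a, b => (a * 2 ^ b) % 2 ^ W
  | .shr, a, b => a / 2 ^ b

/-- The instructions. Registers and program positions are named by natural numbers; a program is a
finite list, so it uses only finitely many registers. -/
inductive Instr where
  /-- `reg d := v mod 2 ^ W`. -/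
  | const (d v : ℕ)
  /-- `reg d := op (reg a) (reg b)`. -/
  | op (o : BinOp) (d a b : ℕ)
  /-- `reg d := mem (reg a)`. -/
  | load (d a : ℕ)
  /-- `mem (reg a) := reg b`. -/
  | store (a b : ℕ)
  /-- Jump to position `t` if `reg a < reg b`. -/
  | jumpLt (a b t : ℕ)
  /-- Jump to position `t` if `reg a = reg b`. -/
  | jumpEq (a b t : ℕ)
  /-- Stop. -/
  | halt

/-- Program counter, registers and memory of the machine. -/
structure State where
  pc : ℕ
  reg : ℕ → ℕ
  mem : ℕ → ℕ

/-- One step of program `P` on the machine with `W`-bit words; `none` if the machine has halted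
(at a `halt` instruction, or because the program counter has left the program). -/
def step (W : ℕ) (P : List Instr) (s : State) : Option State :=
  match P[s.pc]? with
  | none => none
  | some .halt => none
  | some (.const d v) =>
      some { s with pc := s.pc + 1, reg := Function.update s.reg d (v % 2 ^ W) }
  | some (.op o d a b) =>
      some { s with pc := s.pc + 1,
                    reg := Function.update s.reg d (o.eval W (s.reg a) (s.reg b)) }
  | some (.load d a) =>
      some { s with pc := s.pc + 1, reg := Function.update s.reg d (s.mem (s.reg a)) }
  | some (.store a b) =>
      some { s with pc := s.pc + 1, mem := Function.update s.mem (s.reg a) (s.reg b) }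
  | some (.jumpLt a b t) =>
      some { s with pc := if s.reg a < s.reg b then t else s.pc + 1 }
  | some (.jumpEq a b t) =>
      some { s with pc := if s.reg a = s.reg b then t else s.pc + 1 }

/-- The output (the content of register `0`) of program `P` started in state `s`, if the machine
halts within `t` time steps; every executed instruction, including the final `halt`, takes one
time step. -/
def outputWithin (W : ℕ) (P : List Instr) : ℕ → State → Option ℕ
  | 0, _ => none
  | t + 1, s =>
      match step W P s with
      | none => some (s.reg 0)
      | some s' => outputWithin W P t s'

/-- The start state: all registers are `0`; the memory holds, from address `0` on, the words of the
list `data`, and `0` behind them. -/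
def start (data : List ℕ) : State where
  pc := 0
  reg := fun _ => 0
  mem := fun i => data.getD i 0

end WordRAM

/-- The weight `∑ i, x i` of a histogram `x ∈ {0, …, p - 1} ^ n`. -/
def histWeight {n p : ℕ} (x : Fin n → Fin p) : ℕ :=
  ∑ i, (x i : ℕ)

/-- The weighted Jaccard similarity `(∑ i, min (x i) (y i)) / (∑ i, max (x i) (y i))`. -/
noncomputable def weightedJaccard {n p : ℕ} (x y : Fin n → Fin p) : ℝ :=
  (∑ i, min ((x i : ℕ) : ℝ) ((y i : ℕ) : ℝ)) / (∑ i, max ((x i : ℕ) : ℝ) ((y i : ℕ) : ℝ))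

/-- The memory content on which a hash function is evaluated: first its description, which consists
of the fixed words `θ` and the random words `r`, then the entries of the histogram `x`. -/
def hashInput {k q n p : ℕ} (θ : Fin k → ℕ) (r : Fin k → Fin q) (x : Fin n → Fin p) : List ℕ :=
  List.ofFn θ ++ List.ofFn (fun j => (r j : ℕ)) ++ List.ofFn (fun i => (x i : ℕ))

/-! The hash is consistent sampling followed by min-wise hashing, both by random polynomials over
`ZMod Q`, for a prime `Q` between `K * n` and `2 * K * n` with `K` depending only on `ε`. Each
coordinate owns `D` keys. A random linear polynomial gives every key a threshold value, and a key of
coordinate `i` is selected when this value, scaled to `[0, 1)`, is below `x i / N`. Since `x` and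
`y` use the same thresholds, the intersection and the union of their selected sets `S`, `T` are the
sets selected for the pointwise minimum and maximum (`selected_inter`, `selected_union`). Values of
a linear polynomial at two points are independent, so a second-moment bound
(`sum_sq_card_selected_sub_le`) concentrates both sizes around `D / N` times the numerator and the
denominator of `J`.

A second random polynomial, with `m = 4 * D` coefficients, orders the keys, and the hash is its
minimum over the selected set. On at most `m` points its values are exchangeable, so up to ties each
point of `S ∪ T` is equally likely to be the minimum, and the two minima agree exactly when that
point lies in `S ∩ T` (`abs_collision_sub_le`). Averaging over the sample gives
`abs_collision_prob_sub_jaccard_le`, with error small for large `D` and `Q`.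

Evaluation visits `n * D` keys and spends `O(m)` steps on each; `D` and `m` depend only on `ε`, so
the time is even `O(n)`. -/

namespace JaccardHash
open Finset

/-! ### Interpolation and the distribution of values of a random polynomial -/

/-- The value at `z` of the polynomial with coefficients `b`. -/
def polyVal {R : Type*} [CommSemiring R] {m : ℕ} (b : Fin m → R) (z : R) : R :=
  ∑ j, b j * z ^ (j : ℕ)

/-- A Vandermonde matrix with distinct nodes is nonsingular. In probabilistic terms, the values of a
uniformly random polynomial at `m` distinct nodes are independent and uniform; every count below
rests on this. -/
theorem polyVal_bijective {F : Type*} [Field F] [Finite F] {m : ℕ} {f : Fin m → F}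
    (hf : Function.Injective f) :
    Function.Bijective (fun (b : Fin m → F) (j : Fin m) => polyVal b (f j)) := by
  rw [← Finite.injective_iff_bijective]
  intro b b' h
  rw [← sub_eq_zero]
  refine Matrix.eq_zero_of_forall_index_sum_pow_mul_eq_zero hf fun j => ?_
  have := congrFun h j
  simp only [polyVal] at this
  simp only [Pi.sub_apply, mul_sub, sum_sub_distrib, sub_eq_zero]
  simpa only [mul_comm] using this

/-- Interpolation nodes that contain a given small set. -/
theorem exists_nodes {F : Type*} [Fintype F] {m : ℕ} {B : Finset F} (hB : #B ≤ m)
    (hm : m ≤ Fintype.card F) :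
    ∃ f : Fin m → F, Function.Injective f ∧ ∀ z ∈ B, ∃ j, f j = z := by
  obtain ⟨B', hBB', hc⟩ := Finset.exists_superset_card_eq hB hm
  refine ⟨fun j => (B'.equivFinOfCardEq hc).symm j, ?_, fun z hz => ?_⟩
  · exact Subtype.val_injective.comp (Equiv.injective _)
  · exact ⟨B'.equivFinOfCardEq hc ⟨z, hBB' hz⟩, by simp⟩

/-- The values of a random polynomial on a small set are exchangeable. -/
theorem exists_equiv_polyVal_swap {F : Type*} [Field F] [Fintype F] [DecidableEq F] {m : ℕ}
    {B : Finset F} (hB : #B ≤ m) (hm : m ≤ Fintype.card F) {z z' : F} (hz : z ∈ B)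
    (hz' : z' ∈ B) :
    ∃ e : (Fin m → F) ≃ (Fin m → F),
      ∀ b, ∀ y ∈ B, polyVal (e b) y = polyVal b (Equiv.swap z z' y) := by
  obtain ⟨f, hf, hfB⟩ := exists_nodes hB hm
  obtain ⟨i, rfl⟩ := hfB z hz
  obtain ⟨i', rfl⟩ := hfB z' hz'
  -- Pass to the values at the nodes, exchange two of them, and interpolate back.
  let Φ := Equiv.ofBijective _ (polyVal_bijective hf)
  refine ⟨Φ.trans ((Equiv.arrowCongr (Equiv.swap i i') (Equiv.refl F)).trans Φ.symm), ?_⟩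
  intro b y hy
  obtain ⟨j, rfl⟩ := hfB y hy
  have h := congrFun (Φ.apply_symm_apply
    ((Equiv.arrowCongr (Equiv.swap i i') (Equiv.refl F)) (Φ b))) j
  refine h.trans ?_
  simp only [Equiv.arrowCongr_apply, Equiv.symm_swap, Equiv.coe_refl, Function.comp_apply, id]
  change polyVal b (f (Equiv.swap i i' j)) = _
  rw [hf.map_swap]

/-- Two distinct values of a random polynomial agree with probability `1 / q`. -/
theorem card_polyVal_eq_mul {F : Type*} [Field F] [Fintype F] [DecidableEq F] {m : ℕ}
    (hm2 : 2 ≤ m) (hm : m ≤ Fintype.card F) {z z' : F} (hzz' : z ≠ z') :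
    #{b : Fin m → F | polyVal b z = polyVal b z'} * Fintype.card F
      = Fintype.card F ^ m := by
  obtain ⟨f, hf, hfB⟩ := exists_nodes (B := {z, z'}) ((Finset.card_le_two).trans hm2) hm
  obtain ⟨i, hi⟩ := hfB z (by simp)
  obtain ⟨i', hi'⟩ := hfB z' (by simp)
  have hne : i' ≠ i := by rintro rfl; exact hzz' (hi.symm.trans hi')
  let ψ : (Fin m → F) →+ F :=
    { toFun := fun b => polyVal b z - polyVal b z'
      map_zero' := by simp [polyVal]
      map_add' := fun b b' => by
        simp only [polyVal, Pi.add_apply, add_mul, sum_add_distrib]; ring }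
  have hsurj : Function.Surjective ψ := by
    intro s
    obtain ⟨b, hb⟩ := (polyVal_bijective hf).2 (Pi.single i s)
    refine ⟨b, ?_⟩
    have h1 := congrFun hb i
    have h2 := congrFun hb i'
    simp only [hi, hi', Pi.single_eq_same, Pi.single_eq_of_ne hne] at h1 h2
    change polyVal b z - polyVal b z' = s
    rw [h1, h2, sub_zero]
  -- The fibres of a surjective homomorphism have equal size, so the kernel is a `1 / #F` fraction
  -- of all coefficient vectors.
  have hfib : ∀ s : F, #{b | ψ b = s} = #{b | ψ b = 0} := fun s =>
    AddMonoidHom.card_fiber_eq_of_mem_range ψ (hsurj s) (hsurj 0)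
  have htot := Finset.card_eq_sum_card_fiberwise (f := ψ) (s := univ) (t := univ)
    (fun _ _ => by simp)
  simp only [hfib, sum_const, smul_eq_mul, card_univ, Fintype.card_fun, Fintype.card_fin] at htot
  rw [htot, mul_comm]
  congr 2
  ext b
  simp [ψ, sub_eq_zero]

/-! ### Approximate min-wise hashing by polynomials -/

section MinWise

variable {Q : ℕ} [Fact Q.Prime] {m : ℕ}

/-- The smallest value of a polynomial hash function on `S`, and `Q` if `S` is empty. -/
def minValue (b : Fin m → ZMod Q) (S : Finset (ZMod Q)) : ℕ :=
  S.fold min Q fun z => (polyVal b z).val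

/-- The coefficients for which `z` is the unique minimum point on `B`. -/
def uniqueMinAt (m : ℕ) (B : Finset (ZMod Q)) (z : ZMod Q) : Finset (Fin m → ZMod Q) :=
  {b | ∀ y ∈ B, y ≠ z → (polyVal b z).val < (polyVal b y).val}

/-- The coefficients for which two values on `B` agree. -/
def tieOn (m : ℕ) (B : Finset (ZMod Q)) : Finset (Fin m → ZMod Q) :=
  {b | ∃ y ∈ B, ∃ z ∈ B, y ≠ z ∧ polyVal b y = polyVal b z}

/-- Exchanging the values at `z` and `z'` is a bijection on coefficient vectors that carries one
event to the other. -/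
theorem card_uniqueMinAt_eq {B : Finset (ZMod Q)} (hB : #B ≤ m) (hm : m ≤ Q) {z z' : ZMod Q}
    (hz : z ∈ B) (hz' : z' ∈ B) : #(uniqueMinAt m B z) = #(uniqueMinAt m B z') := by
  obtain ⟨e, he⟩ := exists_equiv_polyVal_swap hB (by rwa [ZMod.card]) hz hz'
  have hswap : ∀ y ∈ B, Equiv.swap z z' y ∈ B := by
    intro y hy
    rw [Equiv.swap_apply_def]
    split_ifs <;> assumption
  refine Finset.card_equiv e fun b => ?_
  simp only [uniqueMinAt, mem_filter, mem_univ, true_and]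
  constructor
  · intro h y hy hyz
    rw [he b y hy, he b z' hz', Equiv.swap_apply_right]
    refine h _ (hswap y hy) fun h' => hyz ?_
    simpa using congrArg (Equiv.swap z z') h'
  · intro h y hy hyz
    have h1 := h (Equiv.swap z z' y) (hswap y hy) (fun h' => hyz (by
      simpa using congrArg (Equiv.swap z z') h'))
    rwa [he b _ (hswap y hy), he b z' hz', Equiv.swap_apply_right, Equiv.swap_apply_self] at h1

/-- Union bound over the ordered pairs of distinct points, each of which ties with probability `1 /
Q`. -/
theorem card_tieOn_mul_le {B : Finset (ZMod Q)} (hm2 : 2 ≤ m) (hm : m ≤ Q) :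
    #(tieOn m B) * Q ≤ #B ^ 2 * Q ^ m := by
  have hsub : tieOn m B ⊆ B.offDiag.biUnion fun s =>
      {b : Fin m → ZMod Q | polyVal b s.1 = polyVal b s.2} := by
    intro b hb
    simp only [tieOn, mem_filter, mem_univ, true_and] at hb
    obtain ⟨y, hy, z, hz, hyz, h⟩ := hb
    simp only [mem_biUnion, mem_offDiag, mem_filter, mem_univ, true_and]
    exact ⟨(y, z), ⟨hy, hz, hyz⟩, h⟩
  calc #(tieOn m B) * Q
      ≤ (∑ s ∈ B.offDiag, #{b : Fin m → ZMod Q | polyVal b s.1 = polyVal b s.2}) * Q := by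
        gcongr
        exact (card_le_card hsub).trans card_biUnion_le
    _ = ∑ s ∈ B.offDiag, Q ^ m := by
        rw [sum_mul]
        refine sum_congr rfl fun s hs => ?_
        have := card_polyVal_eq_mul hm2 (by rwa [ZMod.card]) (mem_offDiag.1 hs).2.2
        rwa [ZMod.card] at this
    _ ≤ #B ^ 2 * Q ^ m := by
        rw [sum_const, smul_eq_mul, offDiag_card, sq]
        gcongr
        exact Nat.sub_le _ _

theorem minValue_eq_of_mem {b : Fin m → ZMod Q} {B S : Finset (ZMod Q)} {z : ZMod Q}
    (hb : b ∈ uniqueMinAt m B z) (hS : S ⊆ B) (hz : z ∈ S) :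
    minValue b S = (polyVal b z).val := by
  simp only [uniqueMinAt, mem_filter, mem_univ, true_and] at hb
  refine le_antisymm ((Finset.fold_min_le _).2 (Or.inr ⟨z, hz, le_rfl⟩)) ?_
  refine (Finset.le_fold_min _).2 ⟨(ZMod.val_lt _).le, fun y hy => ?_⟩
  by_cases h : y = z
  · rw [h]
  · exact (hb y (hS hy) h).le

/-- The default `Q` of `minValue` exceeds every hash value, so the strict inequality survives when
`S` is empty. -/
theorem lt_minValue_of_notMem {b : Fin m → ZMod Q} {B S : Finset (ZMod Q)} {z : ZMod Q}
    (hb : b ∈ uniqueMinAt m B z) (hS : S ⊆ B) (hz : z ∉ S) :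
    (polyVal b z).val < minValue b S := by
  simp only [uniqueMinAt, mem_filter, mem_univ, true_and] at hb
  refine (Finset.lt_fold_min _).2 ⟨ZMod.val_lt _, fun y hy => hb y (hS hy) ?_⟩
  rintro rfl
  exact hz hy

theorem pairwiseDisjoint_uniqueMinAt (B : Finset (ZMod Q)) :
    (B : Set (ZMod Q)).PairwiseDisjoint (uniqueMinAt m B) := by
  intro y hy z hz hyz
  rw [Function.onFun, Finset.disjoint_left]
  intro b h1 h2
  simp only [uniqueMinAt, mem_filter, mem_univ, true_and] at h1 h2
  exact lt_asymm (h1 z hz hyz.symm) (h2 y hy hyz)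

theorem exists_mem_uniqueMinAt {B : Finset (ZMod Q)} (hB : B.Nonempty) {b : Fin m → ZMod Q}
    (hb : b ∉ tieOn m B) : ∃ z ∈ B, b ∈ uniqueMinAt m B z := by
  obtain ⟨z, hz, hmin⟩ := B.exists_min_image (fun z => (polyVal b z).val) hB
  refine ⟨z, hz, ?_⟩
  simp only [uniqueMinAt, mem_filter, mem_univ, true_and]
  intro y hy hyz
  refine lt_of_le_of_ne (hmin y hy) fun h => hb ?_
  simp only [tieOn, mem_filter, mem_univ, true_and]
  exact ⟨y, hy, z, hz, hyz, ZMod.val_injective Q h.symm⟩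

/-- A random polynomial of degree less than `m` is nearly min-wise on sets of at most `m` points. -/
theorem abs_collision_sub_le {S T : Finset (ZMod Q)} (hne : (S ∪ T).Nonempty)
    (hB : #(S ∪ T) ≤ m) (hm2 : 2 ≤ m) (hm : m ≤ Q) :
    |(#{b : Fin m → ZMod Q | minValue b S = minValue b T} : ℝ) / Q ^ m
        - (#(S ∩ T) : ℝ) / #(S ∪ T)| ≤ (m : ℝ) ^ 2 / Q := by
  obtain ⟨z₀, hz₀⟩ := hne
  set B := S ∪ T with hBdef
  set e := #(uniqueMinAt m B z₀) with he
  have hcard : ∀ z ∈ B, #(uniqueMinAt m B z) = e := fun z hz => card_uniqueMinAt_eq hB hm hz hz₀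
  set C : Finset (Fin m → ZMod Q) := {b | minValue b S = minValue b T} with hC
  have hAB : S ∩ T ⊆ B := inter_subset_left.trans subset_union_left
  have hA : #((S ∩ T).biUnion (uniqueMinAt m B)) = #(S ∩ T) * e := by
    rw [card_biUnion ((pairwiseDisjoint_uniqueMinAt B).subset (by exact_mod_cast hAB)),
      sum_congr rfl fun z hz => hcard z (hAB hz), sum_const, smul_eq_mul]
  have hBc : #(B.biUnion (uniqueMinAt m B)) = #B * e := by
    rw [card_biUnion (pairwiseDisjoint_uniqueMinAt B), sum_congr rfl hcard, sum_const, smul_eq_mul]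
  -- A unique minimum point of `S ∪ T` in `S ∩ T` forces a collision, and one outside excludes it.
  -- Hence the number of collisions is `#(S ∩ T) * e` up to ties.
  have h1 : #(S ∩ T) * e ≤ #C := by
    rw [← hA]
    refine card_le_card fun b hb => ?_
    obtain ⟨z, hz, hb⟩ := mem_biUnion.1 hb
    simp only [hC, mem_filter, mem_univ, true_and]
    rw [minValue_eq_of_mem hb subset_union_left (mem_inter.1 hz).1,
      minValue_eq_of_mem hb subset_union_right (mem_inter.1 hz).2]
  have h2 : #C ≤ #(tieOn m B) + #(S ∩ T) * e := by
    rw [← hA]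
    refine (card_le_card fun b hb => ?_).trans (card_union_le _ _)
    simp only [hC, mem_filter, mem_univ, true_and] at hb
    by_cases ht : b ∈ tieOn m B
    · exact mem_union_left _ ht
    obtain ⟨z, hz, hbz⟩ := exists_mem_uniqueMinAt ⟨z₀, hz₀⟩ ht
    refine mem_union_right _ (mem_biUnion.2 ⟨z, ?_, hbz⟩)
    by_contra hzA
    rw [mem_inter, not_and_or] at hzA
    rcases mem_union.1 hz with hzS | hzT
    · have hzT : z ∉ T := by tauto
      have := lt_minValue_of_notMem hbz subset_union_right hzT
      rw [← hb, minValue_eq_of_mem hbz subset_union_left hzS] at this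
      exact lt_irrefl _ this
    · have hzS : z ∉ S := by tauto
      have := lt_minValue_of_notMem hbz subset_union_left hzS
      rw [hb, minValue_eq_of_mem hbz subset_union_right hzT] at this
      exact lt_irrefl _ this
  have htotal : Fintype.card (Fin m → ZMod Q) = Q ^ m := by simp
  -- Counting all coefficient vectors in the same way determines `#B * e` as `Q ^ m` up to ties,
  -- which eliminates the unknown `e`.
  have h3 : #B * e ≤ Q ^ m := by
    rw [← hBc, ← htotal]
    exact card_le_univ _
  have h4 : Q ^ m ≤ #(tieOn m B) + #B * e := by
    rw [← hBc, ← htotal, ← card_univ]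
    refine (card_le_card fun b _ => ?_).trans (card_union_le _ _)
    by_cases ht : b ∈ tieOn m B
    · exact mem_union_left _ ht
    · obtain ⟨z, hz, hbz⟩ := exists_mem_uniqueMinAt ⟨z₀, hz₀⟩ ht
      exact mem_union_right _ (mem_biUnion.2 ⟨z, hz, hbz⟩)
  have hQ : (0 : ℝ) < Q := by exact_mod_cast (Fact.out : Q.Prime).pos
  have hQm : (0 : ℝ) < (Q : ℝ) ^ m := by positivity
  have hBpos : (0 : ℝ) < #B := by exact_mod_cast card_pos.2 ⟨z₀, hz₀⟩
  have h5 : (#(tieOn m B) : ℝ) / Q ^ m ≤ (m : ℝ) ^ 2 / Q := by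
    rw [div_le_div_iff₀ hQm hQ]
    have h := card_tieOn_mul_le (B := B) hm2 hm
    have h' : #B ^ 2 * Q ^ m ≤ m ^ 2 * Q ^ m := by gcongr
    exact_mod_cast h.trans h'
  have hAle : (#(S ∩ T) : ℝ) / #B ≤ 1 := by
    rw [div_le_one hBpos]
    exact_mod_cast card_le_card hAB
  have hA0 : (0 : ℝ) ≤ (#(S ∩ T) : ℝ) / #B := by positivity
  have h1' : (#(S ∩ T) : ℝ) * e ≤ #C := by exact_mod_cast h1
  have h2' : (#C : ℝ) ≤ #(tieOn m B) + #(S ∩ T) * e := by exact_mod_cast h2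
  have h3' : (#B : ℝ) * e ≤ Q ^ m := by exact_mod_cast h3
  have h4' : (Q : ℝ) ^ m ≤ #(tieOn m B) + #B * e := by exact_mod_cast h4
  have hconv : (#(S ∩ T) : ℝ) * e = (#(S ∩ T) : ℝ) / #B * (#B * e) := by field_simp
  have ht0 : (0 : ℝ) ≤ #(tieOn m B) := by positivity
  refine le_trans ?_ h5
  have hgoal : |(#C : ℝ) - (#(S ∩ T) : ℝ) / #B * Q ^ m| ≤ #(tieOn m B) := by
    rw [abs_le]
    constructor <;> nlinarith
  have hrw : (#C : ℝ) / Q ^ m - (#(S ∩ T) : ℝ) / #B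
      = ((#C : ℝ) - (#(S ∩ T) : ℝ) / #B * Q ^ m) / Q ^ m := by field_simp
  rw [hrw, abs_div, abs_of_pos hQm]
  gcongr

end MinWise

end JaccardHash

/-! ### Consistent sampling with pairwise independent thresholds -/

namespace JaccardHash
open Finset

/-- Off the diagonal the second moments are those of independent indicators, and the diagonal adds
at most the mean, so the variance is at most `∑ z, p z`. The centre `μ` is free because rounding
makes the true mean differ from the intended one; the gap enters as a squared bias. -/
theorem sum_sq_sub_le_of_pairwise {Ω Z : Type*} [Fintype Ω] [Fintype Z] [DecidableEq Z]
    (I : Z → Ω → ℝ) (p : Z → ℝ) {M : ℝ} (hM : 0 ≤ M) (hI : ∀ z a, I z a * I z a = I z a)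
    (h1 : ∀ z, ∑ a, I z a = M * p z)
    (h2 : ∀ z z', z ≠ z' → ∑ a, I z a * I z' a = M * (p z * p z')) (hcard : Fintype.card Ω = M)
    (μ : ℝ) :
    ∑ a, (∑ z, I z a - μ) ^ 2 ≤ M * (∑ z, p z + (∑ z, p z - μ) ^ 2) := by
  have hpair : ∀ z z', ∑ a, I z a * I z' a ≤ M * (p z * p z') + if z' = z then M * p z else 0 := by
    intro z z'
    split_ifs with h
    · subst h
      rw [sum_congr rfl fun a _ => hI z' a, h1]
      nlinarith [mul_nonneg hM (mul_self_nonneg (p z'))]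
    · rw [h2 z z' (Ne.symm h), add_zero]
  have hexp : ∑ a, (∑ z, I z a - μ) ^ 2
      = ∑ z, ∑ z', ∑ a, I z a * I z' a - 2 * μ * ∑ z, ∑ a, I z a + M * μ ^ 2 := by
    have : ∀ a, (∑ z, I z a - μ) ^ 2
        = ∑ z, ∑ z', I z a * I z' a - 2 * μ * ∑ z, I z a + μ ^ 2 := by
      intro a
      rw [← sum_mul_sum]; ring
    have hcomm : ∑ a, ∑ z, ∑ z', I z a * I z' a = ∑ z, ∑ z', ∑ a, I z a * I z' a := by
      rw [sum_comm]
      exact sum_congr rfl fun z _ => sum_comm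
    simp only [this, sum_add_distrib, sum_sub_distrib, sum_const, card_univ, nsmul_eq_mul, hcard]
    rw [← mul_sum, hcomm, sum_comm (f := fun a z => I z a)]
  have hle : ∑ z, ∑ z', ∑ a, I z a * I z' a ≤ M * ((∑ z, p z) * ∑ z, p z) + M * ∑ z, p z := by
    calc ∑ z, ∑ z', ∑ a, I z a * I z' a
        ≤ ∑ z, ∑ z', (M * (p z * p z') + if z' = z then M * p z else 0) :=
          sum_le_sum fun z _ => sum_le_sum fun z' _ => hpair z z'
      _ = _ := by
          simp only [sum_add_distrib, sum_ite_eq', mem_univ, if_true, ← mul_sum, sum_mul_sum]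
  rw [hexp]
  simp only [h1, ← mul_sum]
  nlinarith

section Sampling

variable {Q : ℕ} [Fact Q.Prime] {n : ℕ}

theorem card_polyVal_two_filter (P : ZMod Q → Prop) [DecidablePred P] (z : ZMod Q) :
    #{a : Fin 2 → ZMod Q | P (polyVal a z)} = Q * #{s | P s} := by
  -- The second node is arbitrary; it only completes `z` to an interpolation set.
  have hinj : Function.Injective ![z, z + 1] := by
    intro i j
    fin_cases i <;> fin_cases j <;> simp
  rw [mul_comm]
  let e := (Equiv.ofBijective _ (polyVal_bijective hinj)).trans (piFinTwoEquiv fun _ => ZMod Q)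
  have : #({s | P s} : Finset (ZMod Q)) * Q
      = #(({s | P s} : Finset (ZMod Q)) ×ˢ (univ : Finset (ZMod Q))) := by
    rw [card_product, card_univ, ZMod.card]
  rw [this]
  refine Finset.card_equiv e fun a => ?_
  simp [e]

theorem card_polyVal_two_filter_and (P P' : ZMod Q → Prop) [DecidablePred P] [DecidablePred P']
    {z z' : ZMod Q} (h : z ≠ z') :
    #{a : Fin 2 → ZMod Q | P (polyVal a z) ∧ P' (polyVal a z')} = #{s | P s} * #{s | P' s} := by
  have hinj : Function.Injective ![z, z'] := by
    intro i j
    fin_cases i <;> fin_cases j <;> simp [h, h.symm]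
  let e := (Equiv.ofBijective _ (polyVal_bijective hinj)).trans (piFinTwoEquiv fun _ => ZMod Q)
  rw [← card_product]
  refine Finset.card_equiv e fun a => ?_
  simp [e]

/-- The number of accepted residues is `c * Q / N` rounded up, so the selection probability exceeds
`c / N` by at most `1 / Q`. -/
theorem card_val_mul_lt_bounds {N c : ℕ} (hN : 1 ≤ N) (hc : c ≤ N) :
    (c : ℝ) / N ≤ (#{s : ZMod Q | s.val * N < c * Q} : ℝ) / Q ∧
      (#{s : ZMod Q | s.val * N < c * Q} : ℝ) / Q ≤ c / N + 1 / Q := by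
  have hQ : (0 : ℝ) < Q := by exact_mod_cast (Fact.out : Q.Prime).pos
  have hN' : (0 : ℝ) < N := by exact_mod_cast hN
  have hcard : #{s : ZMod Q | s.val * N < c * Q} = ⌈(c * Q : ℝ) / N⌉₊ := by
    rw [← card_range ⌈(c * Q : ℝ) / N⌉₊]
    have key : ∀ v : ℕ, v < ⌈(c * Q : ℝ) / N⌉₊ ↔ v * N < c * Q := by
      intro v
      rw [Nat.lt_ceil, lt_div_iff₀ hN']
      exact_mod_cast Iff.rfl
    refine Finset.card_bij (fun s _ => s.val) (fun s hs => ?_) (fun s _ t _ h => ?_) fun v hv => ?_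
    · rw [mem_range, key]; simpa using hs
    · exact ZMod.val_injective Q h
    · rw [mem_range, key] at hv
      have hvQ : v < Q := by
        by_contra hcon
        push Not at hcon
        have := Nat.mul_le_mul hcon hc
        nlinarith
      exact ⟨(v : ZMod Q), by simpa [ZMod.val_natCast_of_lt hvQ] using hv,
        ZMod.val_natCast_of_lt hvQ⟩
  rw [hcard]
  have h1 := Nat.le_ceil ((c * Q : ℝ) / N)
  have h2 := Nat.ceil_lt_add_one (a := (c * Q : ℝ) / N) (by positivity)
  have hrw : (c * Q : ℝ) / N = c / N * Q := by ring
  rw [hrw] at h1 h2 ⊢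
  refine ⟨by rwa [le_div_iff₀ hQ], ?_⟩
  rw [div_le_iff₀ hQ, add_mul, one_div, inv_mul_cancel₀ hQ.ne']
  exact h2.le

/-- The keys among `0, …, n * D - 1` selected for the histogram `c`: each coordinate `i` owns `D`
keys, and each of them is selected with probability about `c i / N`. -/
def selected (N D : ℕ) (a : Fin 2 → ZMod Q) (c : Fin n → ℕ) : Finset (ZMod Q) :=
  Finset.image (fun z : Fin (n * D) => ((z : ℕ) : ZMod Q))
    {z | (polyVal a ((z : ℕ) : ZMod Q)).val * N < c z.divNat * Q}

theorem natCast_key_injective {D : ℕ} (h : n * D ≤ Q) :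
    Function.Injective fun z : Fin (n * D) => ((z : ℕ) : ZMod Q) := by
  intro z z' hz
  have := congrArg ZMod.val hz
  simp only at this
  rw [ZMod.val_natCast_of_lt (z.2.trans_le h), ZMod.val_natCast_of_lt (z'.2.trans_le h)] at this
  exact Fin.ext this

/-- Both histograms test the same value of a key against thresholds monotone in the entry, so
passing both tests means passing the one for the minimum. -/
theorem selected_inter {N D : ℕ} (h : n * D ≤ Q) (a : Fin 2 → ZMod Q) (x y : Fin n → ℕ) :
    selected N D a x ∩ selected N D a y = selected N D a (fun i => min (x i) (y i)) := by
  rw [selected, selected, selected, ← image_inter _ _ (natCast_key_injective h), ← filter_and]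
  congr 2
  ext z
  rw [min_mul_of_nonneg _ _ (Nat.zero_le Q), lt_min_iff]

theorem selected_union {N D : ℕ} (a : Fin 2 → ZMod Q) (x y : Fin n → ℕ) :
    selected N D a x ∪ selected N D a y = selected N D a (fun i => max (x i) (y i)) := by
  rw [selected, selected, selected, ← image_union, ← filter_or]
  congr 2
  ext z
  rw [max_mul_of_nonneg _ _ (Nat.zero_le Q), lt_max_iff]

theorem sum_divNat (D : ℕ) (g : Fin n → ℝ) : ∑ z : Fin (n * D), g z.divNat = D * ∑ i, g i := by
  have := (finProdFinEquiv (m := n) (n := D)).symm.sum_comp (fun s => g s.1)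
  rw [Fintype.sum_prod_type] at this
  simp only [sum_const, card_univ, Fintype.card_fin, nsmul_eq_mul, ← mul_sum] at this
  exact this

theorem sum_sq_card_selected_sub_le {N D : ℕ} (hN : 1 ≤ N) (h : n * D ≤ Q) {c : Fin n → ℕ}
    (hc : ∀ i, c i ≤ N) :
    ∑ a : Fin 2 → ZMod Q, ((#(selected N D a c) : ℝ) - D * (∑ i, (c i : ℝ)) / N) ^ 2
      ≤ (Q : ℝ) ^ 2 * (D * (∑ i, (c i : ℝ)) / N + 2) := by
  have hQ : (0 : ℝ) < Q := by exact_mod_cast (Fact.out : Q.Prime).pos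
  set μ : ℝ := D * (∑ i, (c i : ℝ)) / N with hμ
  let p : Fin (n * D) → ℝ := fun z => (#{s : ZMod Q | s.val * N < c z.divNat * Q} : ℝ) / Q
  let I : Fin (n * D) → (Fin 2 → ZMod Q) → ℝ := fun z a =>
    if (polyVal a ((z : ℕ) : ZMod Q)).val * N < c z.divNat * Q then 1 else 0
  have hsel : ∀ a, (#(selected N D a c) : ℝ) = ∑ z, I z a := by
    intro a
    rw [selected, card_image_of_injective _ (natCast_key_injective h), sum_boole]
  have hmain := sum_sq_sub_le_of_pairwise I p (M := (Q : ℝ) ^ 2) (by positivity)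
    (fun z a => by simp only [I]; split_ifs <;> simp)
    (fun z => by
      simp only [I, p, sum_boole]
      rw [card_polyVal_two_filter (fun s => s.val * N < c z.divNat * Q)]
      push_cast
      field_simp)
    (fun z z' hzz' => by
      have hne : ((z : ℕ) : ZMod Q) ≠ ((z' : ℕ) : ZMod Q) := fun h' =>
        hzz' (natCast_key_injective h h')
      simp only [I, p, ← ite_and, mul_ite, mul_one, mul_zero, sum_boole]
      have := card_polyVal_two_filter_and (fun s => s.val * N < c z'.divNat * Q)
        (fun s => s.val * N < c z.divNat * Q) hne.symm
      rw [this]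
      push_cast
      field_simp) (by simp) μ
  simp only [hsel]
  refine hmain.trans ?_
  have hb := fun z : Fin (n * D) => card_val_mul_lt_bounds (Q := Q) hN (hc z.divNat)
  have hsum : ∑ z : Fin (n * D), (c z.divNat : ℝ) / N = μ := by
    rw [sum_divNat D (fun i => (c i : ℝ) / N), ← sum_div, hμ]; ring
  have hlow : μ ≤ ∑ z, p z := by
    rw [← hsum]
    exact sum_le_sum fun z _ => (hb z).1
  -- There are at most `Q` keys, each with rounding error at most `1 / Q`. The total bias of at most
  -- 1 contributes once through the mean and once squared, whence the `+ 2` in the bound.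
  have hup : ∑ z, p z ≤ μ + 1 := by
    calc ∑ z, p z ≤ ∑ z : Fin (n * D), ((c z.divNat : ℝ) / N + 1 / Q) :=
          sum_le_sum fun z _ => (hb z).2
      _ = μ + (n * D : ℕ) / Q := by
          rw [sum_add_distrib, hsum, sum_const, card_univ, Fintype.card_fin, nsmul_eq_mul,
            mul_one_div]
      _ ≤ μ + 1 := by
          gcongr
          rw [div_le_one hQ]
          exact_mod_cast h
  have hsq : (∑ z, p z - μ) ^ 2 ≤ 1 := by nlinarith
  exact mul_le_mul_of_nonneg_left (by linarith) (by positivity)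

end Sampling

/-! ### The collision probability -/

section Collision

variable {Q : ℕ} [Fact Q.Prime] {n : ℕ}

/-- As `A / B ≤ 1`, an error in the denominator costs no more than an equal error in the numerator.
-/
theorem abs_ratio_sub_ratio_le {A B a b : ℝ} (hA : 0 ≤ A) (hAB : A ≤ B) (hB : 0 < B)
    (hb : 0 < b) : |A / B - a / b| ≤ (|B - b| + |A - a|) / b := by
  have h : A / B - a / b = (A / B * (b - B) + (A - a)) / b := by field_simp; ring
  rw [h, abs_div, abs_of_pos hb]
  gcongr
  refine (abs_add_le _ _).trans (add_le_add ?_ le_rfl)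
  rw [abs_mul, abs_of_nonneg (by positivity : 0 ≤ A / B), abs_sub_comm b B]
  exact mul_le_of_le_one_left (abs_nonneg _) ((div_le_one hB).2 hAB)

/-- The collision probability for fixed sampling coefficients `a`. -/
theorem abs_collision_selected_sub_le {N D m : ℕ} (hD : 1 ≤ D) (h : n * D ≤ Q)
    (hmD : m = 4 * D) (hm : m ≤ Q) (x y : Fin n → ℕ) (a : Fin 2 → ZMod Q) {α β : ℝ}
    (hα : 0 ≤ α) (hαβ : α ≤ β) (hβ : (D : ℝ) ≤ β) (hβ2 : β ≤ 2 * D) :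
    |(#{b : Fin m → ZMod Q | minValue b (selected N D a x) = minValue b (selected N D a y)} : ℝ)
        / Q ^ m - α / β|
      ≤ (|(#(selected N D a fun i => max (x i) (y i)) : ℝ) - β|
          + |(#(selected N D a fun i => min (x i) (y i)) : ℝ) - α|) / D + (m : ℝ) ^ 2 / Q := by
  have hQ : (0 : ℝ) < Q := by exact_mod_cast (Fact.out : Q.Prime).pos
  have hD0 : (0 : ℝ) < D := by exact_mod_cast hD
  have hβ0 : 0 < β := hD0.trans_le hβ
  rw [← selected_inter h, ← selected_union]
  set S := selected N D a x
  set T := selected N D a y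
  set C : Finset (Fin m → ZMod Q) := {b | minValue b S = minValue b T}
  -- When the size of the union is off by at least `D`, the right side is at least 1 and nothing
  -- needs proof. This covers an empty union, and a union of more than `4 * D` points, where the
  -- ordering polynomial is no longer exchangeable.
  have htriv : (D : ℝ) ≤ |(#(S ∪ T) : ℝ) - β| → |(#C : ℝ) / Q ^ m - α / β|
      ≤ (|(#(S ∪ T) : ℝ) - β| + |(#(S ∩ T) : ℝ) - α|) / D + (m : ℝ) ^ 2 / Q := by
    intro hge
    have hC : (#C : ℝ) ≤ Q ^ m := by
      have := card_le_univ C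
      simp only [Fintype.card_fun, ZMod.card, Fintype.card_fin] at this
      exact_mod_cast this
    have h1 : (#C : ℝ) / Q ^ m ≤ 1 := (div_le_one (by positivity)).2 hC
    have h2 : 0 ≤ (#C : ℝ) / Q ^ m := by positivity
    have h3 : α / β ≤ 1 := (div_le_one hβ0).2 hαβ
    have h4 : 0 ≤ α / β := by positivity
    have h5 : 1 ≤ (|(#(S ∪ T) : ℝ) - β| + |(#(S ∩ T) : ℝ) - α|) / D := by
      rw [le_div_iff₀ hD0]
      linarith [abs_nonneg ((#(S ∩ T) : ℝ) - α)]
    have h6 : 0 ≤ (m : ℝ) ^ 2 / Q := by positivity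
    rw [abs_le]
    constructor <;> linarith
  rcases (S ∪ T).eq_empty_or_nonempty with hemp | hne
  · apply htriv
    rw [hemp, card_empty, Nat.cast_zero, zero_sub, abs_neg, abs_of_pos hβ0]
    exact hβ
  by_cases hBm : #(S ∪ T) ≤ m
  · have hB0 : (0 : ℝ) < #(S ∪ T) := by exact_mod_cast card_pos.2 hne
    have hle : (#(S ∩ T) : ℝ) ≤ #(S ∪ T) := by
      exact_mod_cast card_le_card (inter_subset_left.trans subset_union_left)
    have h1 := abs_collision_sub_le hne hBm (by omega) hm
    have h2 := abs_ratio_sub_ratio_le (a := α) (Nat.cast_nonneg _) hle hB0 hβ0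
    have h3 : (|(#(S ∪ T) : ℝ) - β| + |(#(S ∩ T) : ℝ) - α|) / β
        ≤ (|(#(S ∪ T) : ℝ) - β| + |(#(S ∩ T) : ℝ) - α|) / D := by gcongr
    have h4 := abs_sub_le ((#C : ℝ) / Q ^ m) ((#(S ∩ T) : ℝ) / #(S ∪ T)) (α / β)
    linarith
  · apply htriv
    push Not at hBm
    have : (4 * D : ℝ) < #(S ∪ T) := by
      rw [hmD] at hBm
      exact_mod_cast hBm
    rw [abs_of_nonneg (by linarith)]
    linarith

/-- Pointwise `|t| ≤ t ^ 2 / (2 * s) + s / 2`. The free scale `s` avoids the square root of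
Cauchy–Schwarz. -/
theorem sum_abs_le_of_sum_sq_le {Ω : Type*} [Fintype Ω] {f : Ω → ℝ} {V s : ℝ} (hs : 0 < s)
    (h : ∑ a, f a ^ 2 ≤ Fintype.card Ω * V) :
    ∑ a, |f a| ≤ Fintype.card Ω * (V / (2 * s) + s / 2) := by
  have hpt : ∀ t : ℝ, |t| ≤ t ^ 2 / (2 * s) + s / 2 := by
    intro t
    rw [← sq_abs, div_add_div _ _ (by positivity) (by norm_num), le_div_iff₀ (by positivity)]
    nlinarith [sq_nonneg (|t| - s)]
  calc ∑ a, |f a| ≤ ∑ a, (f a ^ 2 / (2 * s) + s / 2) := sum_le_sum fun a _ => hpt _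
    _ = (∑ a, f a ^ 2) / (2 * s) + Fintype.card Ω * (s / 2) := by
        rw [sum_add_distrib, sum_div, sum_const, card_univ, nsmul_eq_mul]
    _ ≤ (Fintype.card Ω * V) / (2 * s) + Fintype.card Ω * (s / 2) := by gcongr
    _ = _ := by ring

theorem abs_collision_prob_sub_jaccard_le {N D m : ℕ} (hN : 1 ≤ N) (hD : 1 ≤ D) (h : n * D ≤ Q)
    (hmD : m = 4 * D) (hm : m ≤ Q) {x y : Fin n → ℕ} (hx : ∑ i, x i = N) (hy : ∑ i, y i = N)
    {δ : ℝ} (hδ : 0 < δ) :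
    |(#{ρ : (Fin 2 → ZMod Q) × (Fin m → ZMod Q) |
          minValue ρ.2 (selected N D ρ.1 x) = minValue ρ.2 (selected N D ρ.1 y)} : ℝ)
        / Q ^ (2 + m) - (∑ i, min (x i : ℝ) (y i)) / ∑ i, max (x i : ℝ) (y i)|
      ≤ 4 / (δ * D) + δ + (m : ℝ) ^ 2 / Q := by
  have hQ : (0 : ℝ) < Q := by exact_mod_cast (Fact.out : Q.Prime).pos
  have hD0 : (0 : ℝ) < D := by exact_mod_cast hD
  have hD1 : (1 : ℝ) ≤ D := by exact_mod_cast hD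
  have hN0 : (0 : ℝ) < N := by exact_mod_cast hN
  have hx' : ∑ i, (x i : ℝ) = N := by exact_mod_cast hx
  have hy' : ∑ i, (y i : ℝ) = N := by exact_mod_cast hy
  have hxN : ∀ i, x i ≤ N := fun i => hx ▸ single_le_sum (fun _ _ => Nat.zero_le _) (mem_univ i)
  have hyN : ∀ i, y i ≤ N := fun i => hy ▸ single_le_sum (fun _ _ => Nat.zero_le _) (mem_univ i)
  set mn : ℝ := ∑ i, min (x i : ℝ) (y i) with hmn
  set mx : ℝ := ∑ i, max (x i : ℝ) (y i) with hmx
  have hmnmx : mn ≤ mx := sum_le_sum fun i _ => min_le_max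
  have hmn0 : 0 ≤ mn := sum_nonneg fun i _ => le_min (Nat.cast_nonneg _) (Nat.cast_nonneg _)
  have hmxN : N ≤ mx := by rw [← hx']; exact sum_le_sum fun i _ => le_max_left _ _
  -- Equal weights enter here: `mx` lies between `N` and `2 * N`, hence `β` between `D` and `2 * D`.
  have hsum : mn + mx = 2 * N := by
    rw [hmn, hmx, ← sum_add_distrib, sum_congr rfl fun i _ => min_add_max (x i : ℝ) (y i),
      sum_add_distrib, hx', hy']
    ring
  set α : ℝ := D * mn / N with hα
  set β : ℝ := D * mx / N with hβ
  have hβD : (D : ℝ) ≤ β := by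
    rw [hβ, le_div_iff₀ hN0]; gcongr
  have hβ2 : β ≤ 2 * D := by
    rw [hβ, div_le_iff₀ hN0]; nlinarith
  have hαβ : α ≤ β := by rw [hα, hβ]; gcongr
  have hα0 : 0 ≤ α := by positivity
  have hratio : mn / mx = α / β := by
    have : (0 : ℝ) < mx := hN0.trans_le hmxN
    rw [hα, hβ]; field_simp
  have hcard : (Fintype.card (Fin 2 → ZMod Q) : ℝ) = (Q : ℝ) ^ 2 := by simp
  have hs : 0 < δ * D := by positivity
  have key : ∀ c : Fin n → ℕ, (∀ i, c i ≤ N) → D * (∑ i, (c i : ℝ)) / N ≤ 2 * D →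
      ∑ a : Fin 2 → ZMod Q, |(#(selected N D a c) : ℝ) - D * (∑ i, (c i : ℝ)) / N|
        ≤ (Q : ℝ) ^ 2 * (2 / δ + δ * D / 2) := by
    intro c hc hle
    have h1 := sum_sq_card_selected_sub_le hN h hc
    rw [← hcard] at h1 ⊢
    refine (sum_abs_le_of_sum_sq_le hs h1).trans ?_
    -- The numerator is at most `2 * D + 2 ≤ 4 * D`.
    have hV : (D * (∑ i, (c i : ℝ)) / N + 2) / (2 * (δ * D)) ≤ 2 / δ := by
      rw [div_le_div_iff₀ (by positivity) hδ]
      nlinarith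
    exact mul_le_mul_of_nonneg_left (by linarith) (by positivity)
  have hmaxsum := key (fun i => max (x i) (y i)) (fun i => max_le (hxN i) (hyN i))
    (by push_cast; exact hβ2)
  have hminsum := key (fun i => min (x i) (y i)) (fun i => (min_le_left _ _).trans (hxN i))
    (by push_cast; exact hαβ.trans hβ2)
  push_cast at hmaxsum hminsum
  rw [← hmx, ← hβ] at hmaxsum
  rw [← hmn, ← hα] at hminsum
  rw [hratio]
  let f : (Fin 2 → ZMod Q) → ℝ := fun a =>
    (#{b : Fin m → ZMod Q | minValue b (selected N D a x) = minValue b (selected N D a y)} : ℝ)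
      / Q ^ m
  have hf : (#{ρ : (Fin 2 → ZMod Q) × (Fin m → ZMod Q) |
          minValue ρ.2 (selected N D ρ.1 x) = minValue ρ.2 (selected N D ρ.1 y)} : ℝ)
        / Q ^ (2 + m) = (∑ a, f a) / Q ^ 2 := by
    have hcount : #{ρ : (Fin 2 → ZMod Q) × (Fin m → ZMod Q) |
          minValue ρ.2 (selected N D ρ.1 x) = minValue ρ.2 (selected N D ρ.1 y)}
        = ∑ a : Fin 2 → ZMod Q, #{b : Fin m → ZMod Q |
            minValue b (selected N D a x) = minValue b (selected N D a y)} := by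
      simp only [card_filter, Fintype.sum_prod_type]
    rw [hcount, Nat.cast_sum, ← sum_div, pow_add, div_div, mul_comm ((Q : ℝ) ^ 2)]
  have hpt := fun a => abs_collision_selected_sub_le (N := N) hD h hmD hm x y a hα0 hαβ hβD hβ2
  have hdiff : (∑ a, f a) / Q ^ 2 - α / β = (∑ a, (f a - α / β)) / Q ^ 2 := by
    rw [sum_sub_distrib, sum_const, card_univ, nsmul_eq_mul, hcard]
    field_simp
  rw [hf, hdiff, abs_div, abs_of_pos (by positivity : (0 : ℝ) < (Q : ℝ) ^ 2),
    div_le_iff₀ (by positivity)]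
  refine (abs_sum_le_sum_abs _ _).trans ((sum_le_sum fun a _ => hpt a).trans ?_)
  rw [sum_add_distrib, ← sum_div, sum_add_distrib, sum_const, card_univ, nsmul_eq_mul, hcard]
  have : ((Q : ℝ) ^ 2 * (2 / δ + δ * D / 2) + (Q : ℝ) ^ 2 * (2 / δ + δ * D / 2)) / D
      = (4 / (δ * D) + δ) * Q ^ 2 := by field_simp; ring
  have hle : (∑ a : Fin 2 → ZMod Q, |(#(selected N D a fun i => max (x i) (y i)) : ℝ) - β|
      + ∑ a : Fin 2 → ZMod Q, |(#(selected N D a fun i => min (x i) (y i)) : ℝ) - α|) / D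
      ≤ (4 / (δ * D) + δ) * Q ^ 2 := by
    rw [← this]
    gcongr
  linarith

end Collision

end JaccardHash

/-! ### Reasoning about runs, one instruction at a time -/

namespace WordRAM

/-- Program `P` started in state `s` halts with output `v` within `T` steps. -/
def HaltsWithin (W : ℕ) (P : List Instr) (s : State) (v T : ℕ) : Prop :=
  ∃ t ≤ T, outputWithin W P t s = some v

theorem HaltsWithin.mono {W : ℕ} {P : List Instr} {s : State} {v T T' : ℕ}
    (h : HaltsWithin W P s v T) (hT : T ≤ T') : HaltsWithin W P s v T' := by
  obtain ⟨t, ht, h⟩ := h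
  exact ⟨t, ht.trans hT, h⟩

theorem HaltsWithin.of_step {W : ℕ} {P : List Instr} {s s' : State} {v T : ℕ}
    (hs : step W P s = some s') (h : HaltsWithin W P s' v T) : HaltsWithin W P s v (T + 1) := by
  obtain ⟨t, ht, h⟩ := h
  refine ⟨t + 1, by omega, ?_⟩
  simp only [outputWithin, hs, h]

section Instructions

variable {W : ℕ} {P : List Instr} {pc : ℕ} {g M : ℕ → ℕ} {v T : ℕ}

theorem HaltsWithin.const {d c val : ℕ} (hP : P[pc]? = some (.const d c)) (hval : c % 2 ^ W = val)
    (h : HaltsWithin W P ⟨pc + 1, Function.update g d val, M⟩ v T) :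
    HaltsWithin W P ⟨pc, g, M⟩ v (T + 1) :=
  .of_step (by simp only [step, hP, hval]) h

theorem HaltsWithin.op {o : BinOp} {d a b val : ℕ} (hP : P[pc]? = some (.op o d a b))
    (hval : o.eval W (g a) (g b) = val)
    (h : HaltsWithin W P ⟨pc + 1, Function.update g d val, M⟩ v T) :
    HaltsWithin W P ⟨pc, g, M⟩ v (T + 1) :=
  .of_step (by simp only [step, hP, hval]) h

theorem HaltsWithin.load {d a val : ℕ} (hP : P[pc]? = some (.load d a)) (hval : M (g a) = val)
    (h : HaltsWithin W P ⟨pc + 1, Function.update g d val, M⟩ v T) :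
    HaltsWithin W P ⟨pc, g, M⟩ v (T + 1) :=
  .of_step (by simp only [step, hP, hval]) h

theorem HaltsWithin.jumpLt_pos {a b t : ℕ} (hP : P[pc]? = some (.jumpLt a b t)) (hlt : g a < g b)
    (h : HaltsWithin W P ⟨t, g, M⟩ v T) : HaltsWithin W P ⟨pc, g, M⟩ v (T + 1) :=
  .of_step (by simp only [step, hP, if_pos hlt]) h

theorem HaltsWithin.jumpLt_neg {a b t : ℕ} (hP : P[pc]? = some (.jumpLt a b t)) (hlt : ¬ g a < g b)
    (h : HaltsWithin W P ⟨pc + 1, g, M⟩ v T) : HaltsWithin W P ⟨pc, g, M⟩ v (T + 1) :=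
  .of_step (by simp only [step, hP, if_neg hlt]) h

theorem HaltsWithin.jumpEq_pos {a b t : ℕ} (hP : P[pc]? = some (.jumpEq a b t)) (heq : g a = g b)
    (h : HaltsWithin W P ⟨t, g, M⟩ v T) : HaltsWithin W P ⟨pc, g, M⟩ v (T + 1) :=
  .of_step (by simp only [step, hP, if_pos heq]) h

theorem HaltsWithin.jumpEq_neg {a b t : ℕ} (hP : P[pc]? = some (.jumpEq a b t)) (heq : g a ≠ g b)
    (h : HaltsWithin W P ⟨pc + 1, g, M⟩ v T) : HaltsWithin W P ⟨pc, g, M⟩ v (T + 1) :=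
  .of_step (by simp only [step, hP, if_neg heq]) h

theorem HaltsWithin.halt (hP : P[pc]? = some .halt) (hv : g 0 = v) :
    HaltsWithin W P ⟨pc, g, M⟩ v 1 :=
  ⟨1, le_rfl, by simp only [outputWithin, step, hP, hv]⟩

end Instructions

end WordRAM

/-! ### The evaluation program, its correctness and its running time -/

namespace JaccardHash
open Finset WordRAM

/-- The evaluation program. Registers: `0` current minimum, `1` the constant one, `2` the modulus,
`3` the weight, `4` current key, `5` number of keys, `6` keys per coordinate, `7` address of the
histogram, `8` and `10` the sampling coefficients, `11` address of the ordering coefficients,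
`20` the constant zero, and scratch registers. -/
def program (D m : ℕ) : List Instr :=
  [.const 1 1,
   .const 6 D,
   .load 5 20,
   .op .mul 5 5 6,
   .load 2 1,
   .load 0 1,
   .const 3 2,
   .load 3 3,
   .const 9 (2 + m),
   .load 10 9,
   .op .add 9 9 1,
   .load 8 9,
   .op .add 11 9 1,
   .const 7 (2 * (2 + m)),
   .jumpEq 4 5 42,
   .op .mul 12 8 4,
   .op .add 12 12 10,
   .op .rem 12 12 2,
   .op .mul 12 12 3,
   .op .div 13 4 6,
   .op .add 13 13 7,
   .load 13 13,
   .op .mul 13 13 2,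
   .jumpLt 12 13 25,
   .jumpEq 1 1 40,
   .const 14 0,
   .const 17 1,
   .op .add 15 11 20,
   .jumpEq 15 7 37,
   .load 16 15,
   .op .mul 16 16 17,
   .op .add 14 14 16,
   .op .rem 14 14 2,
   .op .mul 17 17 4,
   .op .rem 17 17 2,
   .op .add 15 15 1,
   .jumpEq 1 1 28,
   .jumpLt 14 0 39,
   .jumpEq 1 1 40,
   .op .add 0 14 20,
   .op .add 4 4 1,
   .jumpEq 1 1 14,
   .halt]

/-- The memory `M` contains an input of the program on which no operation overflows. -/
structure IsInput (W D m n Q N : ℕ) (M : ℕ → ℕ) : Prop where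
  mem_zero : M 0 = n
  mem_one : M 1 = Q
  mem_two : M 2 = N
  keys_pos : 1 ≤ D
  keys_le : n * D ≤ Q
  one_lt : 1 < Q
  mem_lt : ∀ j < 2 + m, M (2 + m + j) < Q
  sq_lt : Q * Q < 2 ^ W
  mul_lt : Q * N < 2 ^ W
  hist_lt : ∀ i < n, M (2 * (2 + m) + i) * Q < 2 ^ W
  addr_lt : 2 * (2 + m) + n < 2 ^ W

/-- The value of key `z` that decides on its selection. -/
def sampleValue (m Q : ℕ) (M : ℕ → ℕ) (z : ℕ) : ℕ :=
  (M (2 + m + 1) * z + M (2 + m)) % Q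

/-- The value of key `z` after the first `t` ordering coefficients have been processed. -/
def orderValue (m Q : ℕ) (M : ℕ → ℕ) (t z : ℕ) : ℕ :=
  (∑ j ∈ range t, M (2 + m + 2 + j) * z ^ j) % Q

/-- The minimum after the first `Z` keys have been processed. -/
def runningMin (D m Q N : ℕ) (M : ℕ → ℕ) (Z : ℕ) : ℕ :=
  ({z ∈ range Z | sampleValue m Q M z * N < M (2 * (2 + m) + z / D) * Q}).fold min Q
    (orderValue m Q M m)

theorem runningMin_succ_of_lt {D m Q N : ℕ} {M : ℕ → ℕ} {Z : ℕ}
    (h : sampleValue m Q M Z * N < M (2 * (2 + m) + Z / D) * Q) :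
    runningMin D m Q N M (Z + 1) = min (orderValue m Q M m Z) (runningMin D m Q N M Z) := by
  rw [runningMin, range_add_one, filter_insert, if_pos h, fold_insert (by simp), runningMin]

theorem runningMin_succ_of_not_lt {D m Q N : ℕ} {M : ℕ → ℕ} {Z : ℕ}
    (h : ¬ sampleValue m Q M Z * N < M (2 * (2 + m) + Z / D) * Q) :
    runningMin D m Q N M (Z + 1) = runningMin D m Q N M Z := by
  rw [runningMin, range_add_one, filter_insert, if_neg h, runningMin]

/-- The registers that do not change in the main loop. -/
structure LoopRegs (D m n Q N : ℕ) (M g : ℕ → ℕ) : Prop where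
  r1 : g 1 = 1
  r2 : g 2 = Q
  r3 : g 3 = N
  r5 : g 5 = n * D
  r6 : g 6 = D
  r7 : g 7 = 2 * (2 + m)
  r8 : g 8 = M (2 + m + 1)
  r10 : g 10 = M (2 + m)
  r11 : g 11 = 2 + m + 2
  r20 : g 20 = 0

variable {W D m n Q N : ℕ} {M : ℕ → ℕ}

/-- Induction on the number `d` of coefficients left; the invariant keeps the partial sum, the
current power of `z` and the read address. The rest of the run is the continuation `hk`. A round
takes nine instructions, and leaving the loop takes one. -/
theorem haltsWithin_inner (hM : IsInput W D m n Q N M) {z : ℕ} (hz : z < n * D) {v T : ℕ} :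
    ∀ (d t : ℕ) (g : ℕ → ℕ), t + d = m → LoopRegs D m n Q N M g → g 4 = z →
      g 14 = orderValue m Q M t z → g 17 = z ^ t % Q → g 15 = 2 + m + 2 + t →
      (∀ g', LoopRegs D m n Q N M g' → g' 4 = z → g' 0 = g 0 → g' 14 = orderValue m Q M m z →
        HaltsWithin W (program D m) ⟨37, g', M⟩ v T) →
      HaltsWithin W (program D m) ⟨28, g, M⟩ v (T + (9 * d + 1)) := by
  have hQ0 : 0 < Q := zero_lt_one.trans hM.one_lt
  have hzQ : z < Q := hz.trans_le hM.keys_le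
  intro d
  induction d with
  | zero =>
    intro t g ht hg h4 h14 h17 h15 hk
    have htm : t = m := by omega
    subst htm
    -- The ordering coefficients end exactly where the histogram begins, so register `7` also marks
    -- the end of this loop.
    refine .jumpEq_pos rfl (by rw [h15, hg.r7]; omega) (hk g hg h4 rfl h14)
  | succ d ih =>
    intro t g ht hg h4 h14 h17 h15 hk
    have hb : M (2 + m + 2 + t) < Q := by
      have := hM.mem_lt (2 + t) (by omega)
      rwa [← add_assoc] at this
    have hp : z ^ t % Q < Q := Nat.mod_lt _ hQ0
    have ha : orderValue m Q M t z < Q := Nat.mod_lt _ hQ0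
    have hsq := hM.sq_lt
    have haddr := hM.addr_lt
    -- The slack `Q` leaves room for adding the reduced partial sum without overflow.
    have hbp : M (2 + m + 2 + t) * (z ^ t % Q) + Q ≤ Q * Q := by nlinarith
    have hpz : z ^ t % Q * z < Q * Q := Nat.mul_lt_mul'' hp hzQ
    rw [show T + (9 * (d + 1) + 1) = T + (9 * d + 1) + 1 + 1 + 1 + 1 + 1 + 1 + 1 + 1 + 1 by ring]
    refine .jumpEq_neg rfl (by rw [h15, hg.r7]; omega) ?_
    refine .load (val := M (2 + m + 2 + t)) rfl (by rw [h15]) ?_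
    refine .op (val := M (2 + m + 2 + t) * (z ^ t % Q)) rfl
      (by simp [BinOp.eval, h17]; exact Nat.mod_eq_of_lt (by omega)) ?_
    refine .op (val := orderValue m Q M t z + M (2 + m + 2 + t) * (z ^ t % Q)) rfl
      (by simp [BinOp.eval, h14]; exact Nat.mod_eq_of_lt (by omega)) ?_
    refine .op (val := orderValue m Q M (t + 1) z) rfl
      (by
        simp [BinOp.eval, hg.r2, orderValue, sum_range_succ]
        conv_rhs => rw [Nat.add_mod, Nat.mul_mod]
        conv_lhs => rw [Nat.add_mod, Nat.mul_mod]
        simp) ?_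
    refine .op (val := z ^ t % Q * z) rfl
      (by simp [BinOp.eval, h17, h4]; exact Nat.mod_eq_of_lt (by omega)) ?_
    refine .op (val := z ^ (t + 1) % Q) rfl
      (by simp [BinOp.eval, hg.r2, pow_succ]) ?_
    refine .op (val := 2 + m + 2 + (t + 1)) rfl
      (by simp [BinOp.eval, h15, hg.r1]; exact Nat.mod_eq_of_lt (by omega)) ?_
    refine .jumpEq_pos rfl rfl ?_
    refine ih (t + 1) _ (by omega) ?_ ?_ ?_ ?_ ?_ ?_
    · constructor <;> simp [hg.r1, hg.r2, hg.r3, hg.r5, hg.r6, hg.r7, hg.r8,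
        hg.r10, hg.r11, hg.r20]
    · simp [h4]
    · simp
    · simp
    · simp
    · intro g' hg' h4' h0' h14'
      exact hk g' hg' h4' (h0'.trans (by simp)) h14'

/-- The common tail of all three paths through the main loop: key skipped, minimum kept, minimum
replaced. -/
theorem haltsWithin_next (hM : IsInput W D m n Q N M) {z : ℕ} (hz : z < n * D) {v T : ℕ}
    {g : ℕ → ℕ} (hg : LoopRegs D m n Q N M g) (h4 : g 4 = z)
    (hk : ∀ g', LoopRegs D m n Q N M g' → g' 4 = z + 1 → g' 0 = g 0 →
      HaltsWithin W (program D m) ⟨14, g', M⟩ v T) :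
    HaltsWithin W (program D m) ⟨40, g, M⟩ v (T + 2) := by
  have hzQ : z < Q := hz.trans_le hM.keys_le
  have hsq := hM.sq_lt
  have hQQ : Q ≤ Q * Q := Nat.le_mul_self Q
  refine .op (val := z + 1) rfl
    (by simp only [BinOp.eval, h4, hg.r1]; exact Nat.mod_eq_of_lt (by omega)) ?_
  refine .jumpEq_pos rfl rfl (hk _ ?_ ?_ ?_)
  · constructor <;> simp [hg.r1, hg.r2, hg.r3, hg.r5, hg.r6, hg.r7, hg.r8,
      hg.r10, hg.r11, hg.r20]
  · simp
  · simp

theorem haltsWithin_update (hM : IsInput W D m n Q N M) {z : ℕ} (hz : z < n * D) {v T : ℕ}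
    {g : ℕ → ℕ} (hg : LoopRegs D m n Q N M g) (h4 : g 4 = z)
    (h14 : g 14 = orderValue m Q M m z)
    (hk : ∀ g', LoopRegs D m n Q N M g' → g' 4 = z + 1 → g' 0 = min (orderValue m Q M m z) (g 0) →
      HaltsWithin W (program D m) ⟨14, g', M⟩ v T) :
    HaltsWithin W (program D m) ⟨37, g, M⟩ v (T + 4) := by
  have hQ0 : 0 < Q := zero_lt_one.trans hM.one_lt
  have hQQ : Q ≤ Q * Q := Nat.le_mul_self Q
  have ha : orderValue m Q M m z < Q := Nat.mod_lt _ hQ0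
  have hsq := hM.sq_lt
  by_cases h : g 14 < g 0
  · refine .jumpLt_pos rfl h ?_
    refine .op (val := g 14) rfl
      (by simp only [BinOp.eval, hg.r20, h14, add_zero]; exact Nat.mod_eq_of_lt (by omega)) ?_
    refine haltsWithin_next hM hz ?_ (by simp [h4]) fun g' hg' h4' h0' => hk g' hg' h4' ?_
    · constructor <;> simp [hg.r1, hg.r2, hg.r3, hg.r5, hg.r6, hg.r7, hg.r8,
        hg.r10, hg.r11, hg.r20]
    · rw [h0', ← h14, min_eq_left h.le, Function.update_self]
  · refine .jumpLt_neg rfl h (.jumpEq_pos rfl rfl ?_)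
    refine haltsWithin_next hM hz hg h4 fun g' hg' h4' h0' => hk g' hg' h4' ?_
    rw [h0', ← h14, min_eq_right (not_lt.1 h)]

theorem haltsWithin_loop (hM : IsInput W D m n Q N M) :
    ∀ (d z : ℕ) (g : ℕ → ℕ), z + d = n * D → LoopRegs D m n Q N M g → g 4 = z →
      g 0 = runningMin D m Q N M z →
      HaltsWithin W (program D m) ⟨14, g, M⟩ (runningMin D m Q N M (n * D))
        ((18 + 9 * m) * d + 2) := by
  intro d
  induction d with
  | zero =>
    intro z g hz hg h4 h0
    refine .jumpEq_pos rfl (by rw [h4, hg.r5]; omega) (.halt rfl (by rw [h0]; congr 1))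
  | succ d ih =>
    intro z g hz hg h4 h0
    have hQ0 : 0 < Q := zero_lt_one.trans hM.one_lt
    have hzn : z < n * D := by omega
    have hzQ : z < Q := hzn.trans_le hM.keys_le
    have hsq := hM.sq_lt
    have haddr := hM.addr_lt
    have hQQ : Q ≤ Q * Q := Nat.le_mul_self Q
    have hdiv : z / D < n := Nat.div_lt_of_lt_mul (by rwa [mul_comm])
    have ha0 : M (2 + m) < Q := by simpa using hM.mem_lt 0 (by omega)
    have ha1 : M (2 + m + 1) < Q := hM.mem_lt 1 (by omega)
    have haz : M (2 + m + 1) * z + Q ≤ Q * Q := by nlinarith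
    have hs : sampleValue m Q M z < Q := Nat.mod_lt _ hQ0
    have hsN : sampleValue m Q M z * N < 2 ^ W :=
      (Nat.mul_le_mul_right N hs.le).trans_lt hM.mul_lt
    -- The summands follow the longest path: 9 steps up to the selection test, 1 for the test, 3 to
    -- initialise the inner loop, `9 * m + 1` inside it, and 4 to update the minimum and advance.
    have hmain : HaltsWithin W (program D m) ⟨14, g, M⟩ (runningMin D m Q N M (n * D))
        ((18 + 9 * m) * d + 2 + 4 + (9 * m + 1) + 3 + 1 + 9) := by
      refine .jumpEq_neg rfl (by rw [h4, hg.r5]; omega) ?_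
      refine .op (val := M (2 + m + 1) * z) rfl
        (by simp only [BinOp.eval, h4, hg.r8]; exact Nat.mod_eq_of_lt (by omega)) ?_
      refine .op (val := M (2 + m + 1) * z + M (2 + m)) rfl
        (by simp [BinOp.eval, hg.r10]; exact Nat.mod_eq_of_lt (by omega)) ?_
      refine .op (val := sampleValue m Q M z) rfl
        (by simp [BinOp.eval, hg.r2, sampleValue]) ?_
      refine .op (val := sampleValue m Q M z * N) rfl
        (by simp [BinOp.eval, hg.r3]; exact Nat.mod_eq_of_lt hsN) ?_
      refine .op (val := z / D) rfl (by simp [BinOp.eval, hg.r6, h4]) ?_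
      refine .op (val := 2 * (2 + m) + z / D) rfl
        (by simp [BinOp.eval, hg.r7, add_comm (z / D)]; exact Nat.mod_eq_of_lt (by omega)) ?_
      refine .load (val := M (2 * (2 + m) + z / D)) rfl (by simp) ?_
      refine .op (val := M (2 * (2 + m) + z / D) * Q) rfl
        (by simp [BinOp.eval, hg.r2]; exact Nat.mod_eq_of_lt (hM.hist_lt _ hdiv)) ?_
      by_cases hsel : sampleValue m Q M z * N < M (2 * (2 + m) + z / D) * Q
      · refine .jumpLt_pos rfl (by simpa using hsel) ?_
        refine .const (val := 0) rfl (by simp) ?_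
        refine .const (val := 1) rfl (Nat.mod_eq_of_lt (by omega)) ?_
        refine .op (val := 2 + m + 2) rfl (by
          simp [BinOp.eval, hg.r11, hg.r20]
          exact Nat.mod_eq_of_lt (by omega)) ?_
        refine haltsWithin_inner hM hzn m 0 _ (by omega) ?_ ?_ ?_ ?_ ?_
          fun g' hg' h4' h0' h14' => haltsWithin_update hM hzn hg' h4' h14'
            fun g'' hg'' h4'' h0'' => ih (z + 1) g'' (by omega) hg'' h4'' ?_
        · constructor <;> simp [hg.r1, hg.r2, hg.r3, hg.r5, hg.r6, hg.r7,
            hg.r8, hg.r10, hg.r11, hg.r20]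
        · simp [h4]
        · simp [orderValue]
        · simp [Nat.mod_eq_of_lt hM.one_lt]
        · simp
        · rw [h0'', h0', runningMin_succ_of_lt hsel]
          simp [h0]
      · refine .jumpLt_neg rfl (by simpa using hsel) ?_
        refine HaltsWithin.mono (T := (18 + 9 * m) * d + 2 + 2 + 1) (.jumpEq_pos rfl rfl ?_)
          (by omega)
        refine haltsWithin_next hM hzn ?_ (by simp [h4])
          fun g' hg' h4' h0' => ih (z + 1) g' (by omega) hg' h4' ?_
        · constructor <;> simp [hg.r1, hg.r2, hg.r3, hg.r5, hg.r6, hg.r7,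
            hg.r8, hg.r10, hg.r11, hg.r20]
        · rw [h0', runningMin_succ_of_not_lt hsel]
          simp [h0]
    exact hmain.mono (by ring_nf; omega)

theorem haltsWithin_program (hM : IsInput W D m n Q N M) (hDn : D < 2 ^ W) :
    HaltsWithin W (program D m) ⟨0, fun _ => 0, M⟩ (runningMin D m Q N M (n * D))
      ((18 + 9 * m) * (n * D) + 16) := by
  have hQ0 : 0 < Q := zero_lt_one.trans hM.one_lt
  have hQQ : Q ≤ Q * Q := Nat.le_mul_self Q
  have hsq := hM.sq_lt
  have haddr := hM.addr_lt
  have hkeys := hM.keys_le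
  refine .const (val := 1) rfl (Nat.mod_eq_of_lt (by omega)) ?_
  refine .const (val := D) rfl (Nat.mod_eq_of_lt hDn) ?_
  refine .load (val := n) rfl (by simp [hM.mem_zero]) ?_
  refine .op (val := n * D) rfl (by simp [BinOp.eval]; exact Nat.mod_eq_of_lt (by omega)) ?_
  refine .load (val := Q) rfl (by simp [hM.mem_one]) ?_
  refine .load (val := Q) rfl (by simp [hM.mem_one]) ?_
  refine .const (val := 2) rfl (Nat.mod_eq_of_lt (by omega)) ?_
  refine .load (val := N) rfl (by simp [hM.mem_two]) ?_
  refine .const (val := 2 + m) rfl (Nat.mod_eq_of_lt (by omega)) ?_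
  refine .load (val := M (2 + m)) rfl (by simp) ?_
  refine .op (val := 2 + m + 1) rfl
    (by simp [BinOp.eval]; exact Nat.mod_eq_of_lt (by omega)) ?_
  refine .load (val := M (2 + m + 1)) rfl (by simp) ?_
  refine .op (val := 2 + m + 2) rfl
    (by simp [BinOp.eval]; exact Nat.mod_eq_of_lt (by omega)) ?_
  refine .const (val := 2 * (2 + m)) rfl (Nat.mod_eq_of_lt (by omega)) ?_
  refine haltsWithin_loop hM (n * D) 0 _ (by omega) ?_ ?_ ?_
  · constructor <;> simp
  · simp
  · simp [runningMin]

end JaccardHash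

/-! ### From memory contents to the polynomial hash -/

namespace JaccardHash
open Finset WordRAM

section Memory

variable {k q n p : ℕ} (θ : Fin k → ℕ) (r : Fin k → Fin q) (x : Fin n → Fin p)

theorem start_mem_fixed {j : ℕ} (hj : j < k) : (start (hashInput θ r x)).mem j = θ ⟨j, hj⟩ := by
  simp [start, hashInput, List.getD_eq_getElem?_getD, List.getElem?_append, hj]

theorem start_mem_random {j : ℕ} (hj : j < k) :
    (start (hashInput θ r x)).mem (k + j) = (r ⟨j, hj⟩ : ℕ) := by
  simp [start, hashInput, List.getD_eq_getElem?_getD, List.getElem?_append, hj]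

theorem start_mem_hist {i : ℕ} (hi : i < n) :
    (start (hashInput θ r x)).mem (2 * k + i) = (x ⟨i, hi⟩ : ℕ) := by
  have h1 : ¬ k + k + i < k := by omega
  have h2 : k + k + i - k - k = i := by omega
  have h3 : ¬ k + k + i - k < k := by omega
  rw [two_mul]
  simp [start, hashInput, List.getD_eq_getElem?_getD, List.getElem?_append, hi, h1, h2, h3]

end Memory

/-- Splitting the random words into the sampling and the ordering coefficients. -/
noncomputable def splitEquiv (Q m : ℕ) [Fact Q.Prime] :
    (Fin (2 + m) → Fin Q) ≃ (Fin 2 → ZMod Q) × (Fin m → ZMod Q) :=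
  (Equiv.arrowCongr (Equiv.refl _) (ZMod.finEquiv Q).toEquiv).trans (Fin.appendEquiv 2 m).symm

theorem finEquiv_eq_natCast {Q : ℕ} [NeZero Q] (s : Fin Q) :
    ZMod.finEquiv Q s = ((s : ℕ) : ZMod Q) := by
  cases Q with
  | zero => exact s.elim0
  | succ k => exact (Fin.cast_val_eq_self s).symm

theorem runningMin_eq_minValue {D m n p Q N : ℕ} [Fact Q.Prime] (θ : Fin (2 + m) → ℕ)
    (r : Fin (2 + m) → Fin Q) (x : Fin n → Fin p) :
    runningMin D m Q N (start (hashInput θ r x)).mem (n * D)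
      = minValue (splitEquiv Q m r).2 (selected N D (splitEquiv Q m r).1 fun i => (x i : ℕ)) := by
  set M := (start (hashInput θ r x)).mem with hM
  have hs : ∀ z : ℕ, sampleValue m Q M z = (polyVal (splitEquiv Q m r).1 (z : ZMod Q)).val := by
    intro z
    have h0 := start_mem_random θ r x (j := 0) (by omega)
    have h1 := start_mem_random θ r x (j := 1) (by omega)
    rw [add_zero] at h0
    rw [sampleValue, hM, h0, h1, ← ZMod.val_natCast]
    congr 1
    simp only [polyVal, Fin.sum_univ_two, splitEquiv]
    simp [finEquiv_eq_natCast, Fin.appendEquiv, add_comm]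
    rfl
  have ho : ∀ z : ℕ, orderValue m Q M m z = (polyVal (splitEquiv Q m r).2 (z : ZMod Q)).val := by
    intro z
    rw [orderValue, ← ZMod.val_natCast, Finset.sum_range]
    congr 1
    push_cast
    refine sum_congr rfl fun j _ => ?_
    have := start_mem_random θ r x (j := 2 + j) (by omega)
    rw [← add_assoc] at this
    rw [hM, this]
    simp [finEquiv_eq_natCast, Fin.appendEquiv, splitEquiv]
    exact Or.inl rfl
  have hx : ∀ z : Fin (n * D), M (2 * (2 + m) + (z : ℕ) / D) = (x z.divNat : ℕ) := fun z =>
    start_mem_hist θ r x z.divNat.2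
  -- Comparing lower bounds turns both folds into universal statements over the selected keys,
  -- although one runs over naturals and the other over residues.
  refine eq_of_forall_le_iff fun c => ?_
  rw [runningMin, minValue, le_fold_min, le_fold_min, selected, forall_mem_image]
  refine and_congr_right fun _ => ?_
  simp only [mem_filter, mem_range, mem_univ, true_and, and_imp, ho, hs, ← hx]
  exact ⟨fun h z hz => h z z.2 hz, fun h z hz hz' => h (x := ⟨z, hz⟩) hz'⟩

theorem uniformOn_univ_real {Ω : Type*} [Fintype Ω] [MeasurableSpace Ω]
    [MeasurableSingletonClass Ω] (p : Ω → Prop) [DecidablePred p] :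
    (ProbabilityTheory.uniformOn (Set.univ : Set Ω)).real {ω | p ω}
      = (#{ω | p ω} : ℝ) / Fintype.card Ω := by
  have h : MeasureTheory.Measure.count {ω | p ω} = (#{ω | p ω} : ENNReal) := by
    rw [← MeasureTheory.Measure.count_apply_finset]
    simp
  rw [MeasureTheory.measureReal_def, ProbabilityTheory.uniformOn_univ, h, ENNReal.toReal_div]
  simp

/-! ### Choice of parameters and assembly -/

/-- The fixed words of a hash function: the dimension, the modulus and the weight. -/
def fixedWords (k n Q N : ℕ) (j : Fin k) : ℕ :=
  if (j : ℕ) = 0 then n else if (j : ℕ) = 1 then Q else if (j : ℕ) = 2 then N else 0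

/-- The extra assumption `N ≤ n * p` bounds `N` by `2 ^ (2 * w)`, so that the weight and its product
with `Q` fit into a word. -/
theorem exists_hash_of_weight_le (ε : ℝ) (hε : 0 < ε) :
    ∃ (P : List WordRAM.Instr) (c k : ℕ) (C : ℝ), 1 ≤ c ∧
      ∀ n p N w : ℕ, 1 ≤ n → p.Prime → 1 ≤ N → N ≤ n * p → p ≤ 2 ^ w → n ≤ 2 ^ w →
        ∃ (θ : Fin k → ℕ) (q : ℕ) (H : (Fin k → Fin q) → (Fin n → Fin p) → ℕ),
          (∀ j, θ j < 2 ^ (c * w)) ∧ 1 ≤ q ∧ q ≤ 2 ^ (c * w) ∧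
          (∀ (r : Fin k → Fin q) (x : Fin n → Fin p),
            ∃ t : ℕ, (t : ℝ) ≤ C * (n * Real.log p) ∧
              WordRAM.outputWithin (c * w) P t (WordRAM.start (hashInput θ r x)) =
                some (H r x)) ∧
          (∀ x y : Fin n → Fin p, histWeight x = N → histWeight y = N →
            (ProbabilityTheory.uniformOn (Set.univ : Set (Fin k → Fin q))).real
                {r | H r x = H r y} ∈
              Set.Icc (weightedJaccard x y - ε) (weightedJaccard x y + ε)) := by
  -- With `δ = ε / 3`, this makes the sampling term `4 / (δ * D)` at most `ε / 3`. Below, `K₀` does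
  -- the same for the tie term, and adding `m` to it ensures `m ≤ Q` and `n * D ≤ Q`.
  obtain ⟨D, hD⟩ : ∃ D : ℕ, 36 / ε ^ 2 ≤ D := exists_nat_ge _
  have hD0 : (0 : ℝ) < D := lt_of_lt_of_le (by positivity) hD
  have hD1 : 1 ≤ D := by exact_mod_cast hD0
  set m := 4 * D with hmD
  obtain ⟨K₀, hK₀⟩ : ∃ K₀ : ℕ, 3 * (m : ℝ) ^ 2 / ε ≤ K₀ := exists_nat_ge _
  set K := K₀ + m with hK
  -- The summands bound the coefficients in `Q * Q`, in `Q * N` and `p * Q`, and in the largest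
  -- address, relative to powers of `u = 2 ^ w` of exponent at most 3. Then `L < 2 ^ (L * w)` makes
  -- `(L + 3) * w` bits enough.
  set L := 4 * K ^ 2 + 2 * K + 8 * D + 5 with hL
  refine ⟨program D m, L + 3, 2 + m, 2 * ((18 + 9 * m) * D + 16 : ℕ), by omega, ?_⟩
  intro n p N w hn hp hN hNnp hpw hnw
  have hKn0 : K * n ≠ 0 := Nat.mul_ne_zero (by omega) (by omega)
  obtain ⟨Q, hQp, hQK, hQ2⟩ := Nat.exists_prime_lt_and_le_two_mul (K * n) hKn0
  have : Fact Q.Prime := ⟨hQp⟩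
  have hKQ : K ≤ Q := (Nat.le_mul_of_pos_right K hn).trans hQK.le
  have hw : 1 ≤ w := by
    by_contra h
    have : w = 0 := by omega
    subst this
    have := hp.two_le
    omega
  set u := 2 ^ w with hu
  set W := (L + 3) * w with hW
  have hu1 : 1 ≤ u := Nat.one_le_two_pow
  have hWu : ∀ s, s ≤ L * u ^ 3 → s < 2 ^ W := by
    intro s hs
    refine hs.trans_lt ?_
    rw [hW, add_mul L 3 w, pow_add, mul_comm 3 w, pow_mul 2 w 3]
    refine Nat.mul_lt_mul_of_pos_right ?_ (by positivity)
    exact (Nat.lt_two_pow_self).trans_le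
      (Nat.pow_le_pow_right (by norm_num) (Nat.le_mul_of_pos_right L hw))
  have hu2 : u ≤ u ^ 2 := Nat.le_self_pow (by norm_num) u
  have hu3 : u ^ 2 ≤ u ^ 3 := Nat.pow_le_pow_right hu1 (by norm_num)
  have hQu : Q ≤ 2 * K * u := by
    calc Q ≤ 2 * (K * n) := hQ2
      _ ≤ 2 * (K * u) := by gcongr
      _ = 2 * K * u := by ring
  have hNu : N ≤ u ^ 2 := by
    calc N ≤ n * p := hNnp
      _ ≤ u * u := by gcongr
      _ = u ^ 2 := by ring
  have hQQ : Q * Q < 2 ^ W := hWu _ <| by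
    calc Q * Q ≤ (2 * K * u) * (2 * K * u) := by gcongr
      _ = 4 * K ^ 2 * u ^ 2 := by ring
      _ ≤ L * u ^ 3 := by gcongr; omega
  have hQN : Q * N < 2 ^ W := hWu _ <| by
    calc Q * N ≤ (2 * K * u) * u ^ 2 := by gcongr
      _ = 2 * K * u ^ 3 := by ring
      _ ≤ L * u ^ 3 := by gcongr; omega
  have hpQ : p * Q < 2 ^ W := hWu _ <| by
    calc p * Q ≤ u * (2 * K * u) := by gcongr
      _ = 2 * K * u ^ 2 := by ring
      _ ≤ L * u ^ 3 := by gcongr; omega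
  have haddr : 2 * (2 + m) + n < 2 ^ W := hWu _ <| by
    calc 2 * (2 + m) + n ≤ (2 * (2 + m)) * u + 1 * u := by
          refine Nat.add_le_add (Nat.le_mul_of_pos_right _ hu1) ?_
          rwa [one_mul]
      _ = (2 * (2 + m) + 1) * u := by ring
      _ ≤ L * u ^ 3 := Nat.mul_le_mul (by omega) (hu2.trans hu3)
  have hQW : Q < 2 ^ W := (Nat.le_mul_self Q).trans_lt hQQ
  have hNW : N < 2 ^ W := (Nat.le_mul_of_pos_left N hQp.pos).trans_lt hQN
  have hkeys : n * D ≤ Q := by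
    calc n * D ≤ n * K := by gcongr; omega
      _ = K * n := mul_comm _ _
      _ ≤ Q := hQK.le
  have hmQ : m ≤ Q := by omega
  have hinput : ∀ (r : Fin (2 + m) → Fin Q) (x : Fin n → Fin p),
      IsInput W D m n Q N (start (hashInput (fixedWords (2 + m) n Q N) r x)).mem := by
    intro r x
    refine ⟨?_, ?_, ?_, hD1, hkeys, hQp.one_lt, ?_, hQQ, hQN, ?_, haddr⟩
    · rw [start_mem_fixed _ _ _ (by omega)]; rfl
    · rw [start_mem_fixed _ _ _ (by omega)]; rfl
    · rw [start_mem_fixed _ _ _ (by omega)]; rfl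
    · intro j hj
      rw [start_mem_random _ _ _ hj]
      exact (r _).2
    · intro i hi
      rw [start_mem_hist _ _ _ hi]
      exact (Nat.mul_le_mul_right Q (x _).2.le).trans_lt hpQ
  refine ⟨fixedWords (2 + m) n Q N, Q, fun r x =>
    minValue (splitEquiv Q m r).2 (selected N D (splitEquiv Q m r).1 fun i => (x i : ℕ)),
    fun j => ?_, hQp.one_lt.le, hQW.le, fun r x => ?_, fun x y hx hy => ?_⟩
  · rw [fixedWords]
    split_ifs <;> omega
  · obtain ⟨t, ht, h⟩ := haltsWithin_program (hinput r x) (by omega)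
    refine ⟨t, ?_, h.trans (congrArg some (runningMin_eq_minValue _ r x))⟩
    -- The run takes `O(n)` steps; this lower bound, with the factor 2 in `C`, brings in `log p`.
    have hlog : (1 : ℝ) / 2 ≤ Real.log p := by
      have h2 : Real.log 2 ≤ Real.log p :=
        Real.log_le_log (by norm_num) (by exact_mod_cast hp.two_le)
      linarith [Real.log_two_gt_d9]
    have ht' : t ≤ ((18 + 9 * m) * D + 16) * n := by
      refine ht.trans ?_
      calc (18 + 9 * m) * (n * D) + 16 ≤ (18 + 9 * m) * (n * D) + 16 * n := by gcongr; omega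
        _ = _ := by ring
    calc (t : ℝ) ≤ (((18 + 9 * m) * D + 16 : ℕ) : ℝ) * n := by exact_mod_cast ht'
      _ = 2 * (((18 + 9 * m) * D + 16 : ℕ) : ℝ) * (n * (1 / 2)) := by ring
      _ ≤ _ := by gcongr
  · rw [uniformOn_univ_real]
    have hcount := Finset.card_equiv (splitEquiv Q m)
      (s := {r : Fin (2 + m) → Fin Q |
        minValue (splitEquiv Q m r).2 (selected N D (splitEquiv Q m r).1 fun i => (x i : ℕ)) =
        minValue (splitEquiv Q m r).2 (selected N D (splitEquiv Q m r).1 fun i => (y i : ℕ))})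
      (t := {ρ | minValue ρ.2 (selected N D ρ.1 fun i => (x i : ℕ)) =
        minValue ρ.2 (selected N D ρ.1 fun i => (y i : ℕ))}) (fun r => by simp)
    have hmain := abs_collision_prob_sub_jaccard_le hN hD1 hkeys hmD hmQ hx hy
      (δ := ε / 3) (by positivity)
    rw [← hcount] at hmain
    have hcard : (Fintype.card (Fin (2 + m) → Fin Q) : ℝ) = (Q : ℝ) ^ (2 + m) := by simp
    have hQ0 : (0 : ℝ) < Q := by exact_mod_cast hQp.pos
    have e1 : 4 / (ε / 3 * D) ≤ ε / 3 := by
      rw [div_le_iff₀ (by positivity)] at hD ⊢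
      nlinarith
    have e2 : (m : ℝ) ^ 2 / Q ≤ ε / 3 := by
      have hK₀Q : (K₀ : ℝ) ≤ Q := by exact_mod_cast (Nat.le_add_right K₀ m).trans hKQ
      rw [div_le_iff₀ hε] at hK₀
      rw [div_le_iff₀ hQ0]
      nlinarith
    have hfin := abs_le.1 (hmain.trans (by linarith : _ ≤ ε))
    rw [hcard, weightedJaccard]
    exact ⟨by linarith [hfin.1], by linarith [hfin.2]⟩

theorem histWeight_le {n p : ℕ} (x : Fin n → Fin p) : histWeight x ≤ n * p := by
  calc histWeight x ≤ ∑ _i : Fin n, p := sum_le_sum fun i _ => (x i).2.le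
    _ = n * p := by simp

end JaccardHash

/-- The program `P`, the factor `c` in the word size, the number `2 * k` of words in the description
of a hash function, and the factor `C` in the running time depend on `ε` only. The random hash
function is `H r`, with `r` uniformly distributed over `{0, …, q - 1} ^ k`. -/
theorem theorem1 (ε : ℝ) (hε : 0 < ε) :
    ∃ (P : List WordRAM.Instr) (c k : ℕ) (C : ℝ), 1 ≤ c ∧
      ∀ n p N w : ℕ, 1 ≤ n → p.Prime → 1 ≤ N → p ≤ 2 ^ w → n ≤ 2 ^ w →
        ∃ (θ : Fin k → ℕ) (q : ℕ) (H : (Fin k → Fin q) → (Fin n → Fin p) → ℕ),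
          (∀ j, θ j < 2 ^ (c * w)) ∧ 1 ≤ q ∧ q ≤ 2 ^ (c * w) ∧
          (∀ (r : Fin k → Fin q) (x : Fin n → Fin p),
            ∃ t : ℕ, (t : ℝ) ≤ C * (n * Real.log p) ∧
              WordRAM.outputWithin (c * w) P t (WordRAM.start (hashInput θ r x)) =
                some (H r x)) ∧
          (∀ x y : Fin n → Fin p, histWeight x = N → histWeight y = N →
            (ProbabilityTheory.uniformOn (Set.univ : Set (Fin k → Fin q))).real
                {r | H r x = H r y} ∈
              Set.Icc (weightedJaccard x y - ε) (weightedJaccard x y + ε)) := by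
  obtain ⟨P, c, k, C, hc, h⟩ := JaccardHash.exists_hash_of_weight_le ε hε
  refine ⟨P, c, k, C, hc, fun n p N w hn hp hN hpw hnw => ?_⟩
  -- No histogram has weight above `n * p`, so beyond it the collision condition is vacuous and the
  -- hash for weight 1 serves.
  by_cases hNnp : N ≤ n * p
  · exact h n p N w hn hp hN hNnp hpw hnw
  · obtain ⟨θ, q, H, hθ, hq, hqw, hH, -⟩ :=
      h n p 1 w hn hp le_rfl (Nat.mul_pos hn hp.pos) hpw hnw
    exact ⟨θ, q, H, hθ, hq, hqw, hH, fun x _ hx _ =>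
      absurd (hx ▸ JaccardHash.histWeight_le x) hNnp⟩
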